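/- For $n\ge 1$ let $f(n)$ be the maximum number of edges of a graph on $n$ vertices in which no two cycles have the same length; here a graph is finite and may have loops and parallel edges, a loop is a cycle of length $1$ and a pair of parallel edges is a cycle of length $2$. Let $f^*(n)$ be the same maximum taken over simple graphs only. Let $t=1260r+169$ with an integer $r\ge 1$. Then for every integer $n\ge \frac{1309}{2}t^2-\frac{1349159}{6}t+\frac{6932215}{3}$, $$f(n)\ \ge\ n+\frac{119}{3}t-\frac{26399}{3},$$ and the same bound holds for simple graphs: $f^*(n)\ge n+\frac{119}{3}t-\frac{26399}{3}$. -/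

import Mathlib

/-- `G.IsCycleEdgeSet C k`: the set of edges `C` is the edge set of a cycle of length `k` in the
(multi)graph `G`, that is, there are `k ≥ 1` distinct vertices `v i` and `k` distinct edges `e i`,
indexed cyclically, such that `e i` joins `v i` to `v (i + 1)`. So a loop is a cycle of length `1`
and two parallel edges form a cycle of length `2`. A cycle, as a subgraph, is determined by its
edge set. -/
def Graph.IsCycleEdgeSet {α β : Type*} (G : Graph α β) (C : Set β) (k : ℕ) : Prop :=
  0 < k ∧ ∃ (v : ZMod k → α) (e : ZMod k → β), Function.Injective v ∧ Function.Injective e ∧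
    (∀ i, G.IsLink (e i) (v i) (v (i + 1))) ∧ Set.range e = C

/-- No two different cycles of `G` have the same length. -/
def Graph.DistinctCycleLengths {α β : Type*} (G : Graph α β) : Prop :=
  ∀ (C D : Set β) (k : ℕ), G.IsCycleEdgeSet C k → G.IsCycleEdgeSet D k → C = D

/-- The possible numbers of edges of a graph on `n` vertices (loops and parallel edges allowed)
in which no two cycles have the same length. -/
def edgeCounts (n : ℕ) : Set ℕ :=
  {m | ∃ G : Graph (Fin n) (Fin m), G.vertexSet = Set.univ ∧ G.edgeSet = Set.univ ∧
    G.DistinctCycleLengths}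

/-- The possible numbers of edges of a simple graph on `n` vertices
in which no two cycles have the same length. -/
def simpleEdgeCounts (n : ℕ) : Set ℕ :=
  {m | ∃ G : Graph (Fin n) (Fin m), G.vertexSet = Set.univ ∧ G.edgeSet = Set.univ ∧
    G.Simple ∧ G.DistinctCycleLengths}

/-- `maxEdges n`: the maximum number of edges in a graph on `n` vertices (loops and parallel edges
allowed) in which no two cycles have the same length. It is a true maximum: see `isGreatest_maxEdges`. -/
noncomputable def maxEdges (n : ℕ) : ℕ := sSup (edgeCounts n)

/-- `maxEdgesSimple n`: the maximum number of edges in a simple graph on `n` vertices in which no two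
cycles have the same length. It is a true maximum: see `isGreatest_maxEdgesSimple`. -/
noncomputable def maxEdgesSimple (n : ℕ) : ℕ := sSup (simpleEdgeCounts n)

theorem Graph.isCycleEdgeSet_loop {α β : Type*} {G : Graph α β} {a : β} {x : α}
    (h : G.IsLink a x x) : G.IsCycleEdgeSet {a} 1 := by
  refine ⟨one_pos, fun _ => x, fun _ => a, ?_, ?_, fun _ => h, ?_⟩
  · exact fun i j _ => Subsingleton.elim (α := Fin 1) i j
  · exact fun i j _ => Subsingleton.elim (α := Fin 1) i j
  · exact Set.range_const

theorem Graph.isCycleEdgeSet_pair {α β : Type*} {G : Graph α β} {a b : β} {x y : α}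
    (hab : a ≠ b) (hxy : x ≠ y) (ha : G.IsLink a x y) (hb : G.IsLink b x y) :
    G.IsCycleEdgeSet {a, b} 2 := by
  refine ⟨two_pos, (![x, y] : Fin 2 → α), (![a, b] : Fin 2 → β), ?_, ?_, ?_, ?_⟩
  · change Function.Injective (![x, y] : Fin 2 → α)
    intro i j
    fin_cases i <;> fin_cases j <;> simp [hxy, hxy.symm]
  · change Function.Injective (![a, b] : Fin 2 → β)
    intro i j
    fin_cases i <;> fin_cases j <;> simp [hab, hab.symm]
  · change ∀ i : Fin 2, G.IsLink ((![a, b] : Fin 2 → β) i) ((![x, y] : Fin 2 → α) i)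
      ((![x, y] : Fin 2 → α) (i + 1))
    intro i
    fin_cases i
    · simpa using ha
    · simpa using (G.isLink_comm.1 hb)
  · change Set.range (![a, b] : Fin 2 → β) = _
    ext d; simp [eq_comm, or_comm]

theorem bddAbove_edgeCounts (n : ℕ) : BddAbove (edgeCounts n) := by
  refine ⟨2 * Fintype.card (Sym2 (Fin n)), ?_⟩
  rintro m ⟨G, -, hE, hG⟩
  by_contra! hm
  have hex : ∀ a : Fin m, ∃ x y, G.IsLink a x y := fun a =>
    G.exists_isLink_of_mem_edgeSet (by rw [hE]; trivial)
  choose p q hpq using hex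
  obtain ⟨z, -, hz⟩ := Finset.exists_lt_card_fiber_of_mul_lt_card_of_maps_to
    (s := (Finset.univ : Finset (Fin m))) (t := (Finset.univ : Finset (Sym2 (Fin n))))
    (f := fun a => s(p a, q a)) (n := 2) (fun _ _ => Finset.mem_univ _)
    (by simpa [mul_comm] using hm)
  obtain ⟨a, b, c, ha, hb, hc, hab, hac, hbc⟩ := Finset.two_lt_card_iff.1 hz
  simp only [Finset.mem_filter, Finset.mem_univ, true_and] at ha hb hc
  have key : ∀ d : Fin m, s(p d, q d) = z → G.IsLink d (p a) (q a) := by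
    intro d hd
    exact ((hpq d).isLink_iff_sym2_eq).2 (hd.trans ha.symm)
  by_cases hxy : p a = q a
  · have h1 : ∀ d : Fin m, s(p d, q d) = z → G.IsCycleEdgeSet {d} 1 := fun d hd =>
      Graph.isCycleEdgeSet_loop (x := p a) (by simpa [← hxy] using key d hd)
    exact hab (Set.singleton_injective (hG _ _ _ (h1 a ha) (h1 b hb)))
  · have h1 := Graph.isCycleEdgeSet_pair hab hxy (key a ha) (key b hb)
    have h2 := Graph.isCycleEdgeSet_pair hac hxy (key a ha) (key c hc)
    have h3 := hG _ _ _ h1 h2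
    have : b ∈ ({a, c} : Set (Fin m)) := h3 ▸ (by simp)
    rcases this with h | h
    · exact hab h.symm
    · exact hbc h

theorem simpleEdgeCounts_subset (n : ℕ) : simpleEdgeCounts n ⊆ edgeCounts n :=
  fun _ ⟨G, hV, hE, _, hG⟩ => ⟨G, hV, hE, hG⟩

theorem zero_mem_simpleEdgeCounts (n : ℕ) : 0 ∈ simpleEdgeCounts n := by
  refine ⟨Graph.noEdge Set.univ (Fin 0), rfl, Subsingleton.elim _ _, inferInstance, ?_⟩
  exact fun C D _ _ _ => Subsingleton.elim C D

theorem isGreatest_maxEdges (n : ℕ) : IsGreatest (edgeCounts n) (maxEdges n) :=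
  ⟨Nat.sSup_mem ⟨0, simpleEdgeCounts_subset n (zero_mem_simpleEdgeCounts n)⟩
    (bddAbove_edgeCounts n), fun _ h => le_csSup (bddAbove_edgeCounts n) h⟩

theorem isGreatest_maxEdgesSimple (n : ℕ) : IsGreatest (simpleEdgeCounts n) (maxEdgesSimple n) :=
  have hb := (bddAbove_edgeCounts n).mono (simpleEdgeCounts_subset n)
  ⟨Nat.sSup_mem ⟨0, zero_mem_simpleEdgeCounts n⟩ hb, fun _ h => le_csSup hb h⟩

/-!
The graph is a union of vertex-disjoint blocks, each attached by a bridge to one further vertex,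
the root. Such a graph has `n - 1 + g` edges, where `g` is the sum of the cyclomatic numbers of
the blocks, so the aim is to reach a large `g` with few vertices while using no cycle length
twice. Short lengths are best spent on single cycles. Medium lengths are spent on theta graphs,
which get two additional edges out of three lengths, at the cost of half their sum in edges. Long
lengths are spent on subdivisions of the wheel with four spokes, which get four additional edges
out of thirteen lengths.

The decisive point is that the wheels can use an interval of lengths without gaps: if the spokes
have lengths `4, 5.5, 3.5, 5` and the rim edges `5.5, 3, 5.5, 4`, then the thirteen cycles have
the lengths `12, 13, ..., 24`. For a parameter `z` this wheel is scaled by `24 * z` and then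
perturbed. When each spoke is lengthened by `2 * m` and one rim edge is shortened by `8 * m`, the
cycles with two spokes change by `4 * m` or `-4 * m` and the rim by `-8 * m`. Together with a
choice `h` between the two halves of every interval, and with four sets `d` of bounded corrections
that realize every residue modulo `4` (modulo `8` together with `h` for the rim), this gives
`8 * (3 * z - 1)` wheels, whose `i`-th shortest cycles have distinct lengths in the `i`-th of thirteen
consecutive intervals of length `24 * z`, which start at `276 * z` (`wheelLen_cycle`,
`wheelLen_cycle_injective`). In the same way `28 * z` theta graphs fill three intervals between
`192 * z` and `276 * z` (`thetaLen_cycle`), and the single cycles have the lengths from `3` to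
`192 * z - 1`. The result (`exists_mem_simpleEdgeCounts`) is `n + 344 * z - 36` edges for every
`n ≥ 48996 * z ^ 2`, and `344 ^ 2 / 48996` exceeds the ratio `(119 / 3) ^ 2 / (1309 / 2)` that the
theorem demands.

That there are no other cycles follows from necessary conditions only: a cycle has degree `0` or
`2` at every vertex and is connected. In a subdivision it therefore consists of whole paths
(`Graph.IsCycleEdgeSet.subdiv_mem`), and in each block it uses no path or those of one of the
thirteen cycles of the wheel (`eq_empty_or_eq_wheelCycle`); in particular it avoids the bridges,
hence stays in one block (`exists_wheelCycle`). Single cycles and theta graphs are wheels with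
some rim edges deleted, so that all blocks are treated alike.
-/

/-! ### Cycles in a graph given by the two ends of each edge -/

/-- The multigraph on all of `V`, with all of `E` as edges, in which `e` joins `s e` to `t e`. -/
def endsGraph {V E : Type*} (s t : E → V) : Graph V E where
  vertexSet := Set.univ
  IsLink e x y := s e = x ∧ t e = y ∨ s e = y ∧ t e = x
  edgeSet := Set.univ
  isLink_symm := fun _ _ => ⟨fun _ _ h => h.symm⟩
  eq_or_eq_of_isLink_of_isLink := by
    rintro e x y v w (⟨rfl, rfl⟩ | ⟨rfl, rfl⟩) (⟨h, h'⟩ | ⟨h, h'⟩) <;> simp [h, h']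
  edge_mem_iff_exists_isLink := fun e => ⟨fun _ => ⟨s e, t e, Or.inl ⟨rfl, rfl⟩⟩, fun _ => trivial⟩
  left_mem_of_isLink := fun _ _ _ _ => trivial

/-- `Touches s t e x`: the vertex `x` is an end of the edge `e`. -/
def Touches {V E : Type*} (s t : E → V) (e : E) (x : V) : Prop := s e = x ∨ t e = x

section Cycle

variable {V E : Type*} {s t : E → V} {C : Set E} {k : ℕ}

theorem Graph.IsCycleEdgeSet.ncard_eq (h : (endsGraph s t).IsCycleEdgeSet C k) : C.ncard = k := by
  obtain ⟨-, v, e, -, he, -, rfl⟩ := h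
  rw [← Set.image_univ, Set.ncard_image_of_injective _ he, Set.ncard_univ, Nat.card_zmod]

theorem Graph.IsCycleEdgeSet.nonempty (h : (endsGraph s t).IsCycleEdgeSet C k) : C.Nonempty := by
  obtain ⟨-, v, e, -, -, -, rfl⟩ := h
  exact Set.range_nonempty e

/-- In a loopless graph, a cycle through an end `x` of one of its edges leaves `x` by another
edge. -/
theorem Graph.IsCycleEdgeSet.exists_other (h : (endsGraph s t).IsCycleEdgeSet C k)
    (hl : ∀ e, s e ≠ t e) {a : E} {x : V} (ha : a ∈ C) (hx : Touches s t a x) :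
    ∃ b ∈ C, b ≠ a ∧ Touches s t b x := by
  obtain ⟨hk, v, e, hv, he, hlink, rfl⟩ := h
  obtain ⟨i, rfl⟩ := ha
  have hone : (1 : ZMod k) ≠ 0 := by
    intro h1
    rcases hlink i with ⟨h2, h3⟩ | ⟨h2, h3⟩ <;> rw [h1, add_zero] at * <;>
      exact hl _ (h2.trans h3.symm)
  have hx' : x = v i ∨ x = v (i + 1) := by
    rcases hlink i with ⟨h2, h3⟩ | ⟨h2, h3⟩ <;> rcases hx with rfl | rfl <;> simp_all
  rcases hx' with rfl | rfl
  · refine ⟨e (i - 1), ⟨_, rfl⟩, fun hh => hone ?_, ?_⟩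
    · simpa using he hh
    · have := hlink (i - 1)
      rw [sub_add_cancel] at this
      rcases this with ⟨h2, h3⟩ | ⟨h2, h3⟩
      exacts [Or.inr h3, Or.inl h2]
  · refine ⟨e (i + 1), ⟨_, rfl⟩, fun hh => hone ?_, ?_⟩
    · simpa using he hh
    · rcases hlink (i + 1) with ⟨h2, h3⟩ | ⟨h2, h3⟩
      exacts [Or.inl h2, Or.inr h3]

/-- A cycle has at most two edges at a vertex. -/
theorem Graph.IsCycleEdgeSet.not_three (h : (endsGraph s t).IsCycleEdgeSet C k)
    {a b c : E} {x : V} (ha : a ∈ C) (hb : b ∈ C) (hc : c ∈ C) (hab : a ≠ b) (hac : a ≠ c)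
    (hbc : b ≠ c) (hxa : Touches s t a x) (hxb : Touches s t b x) (hxc : Touches s t c x) :
    False := by
  obtain ⟨hk, v, e, hv, he, hlink, rfl⟩ := h
  have key : ∀ i, Touches s t (e i) x → x = v i ∨ x = v (i + 1) := by
    intro i hx
    rcases hlink i with ⟨h2, h3⟩ | ⟨h2, h3⟩ <;> rcases hx with rfl | rfl <;> simp_all
  obtain ⟨i, rfl⟩ := ha
  obtain ⟨j, rfl⟩ := hb
  obtain ⟨l, rfl⟩ := hc
  have inj : ∀ p q : ZMod k, v p = v q → e p = e q := fun p q hpq => by rw [hv hpq]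
  have inj' : ∀ p q : ZMod k, v (p + 1) = v (q + 1) → e p = e q := fun p q hpq => by
    rw [add_right_cancel (hv hpq)]
  rcases key i hxa with h1 | h1 <;> rcases key j hxb with h2 | h2 <;>
    rcases key l hxc with h3 | h3
  · exact hab (inj _ _ (h1.symm.trans h2))
  · exact hab (inj _ _ (h1.symm.trans h2))
  · exact hac (inj _ _ (h1.symm.trans h3))
  · exact hbc (inj' _ _ (h2.symm.trans h3))
  · exact hbc (inj _ _ (h2.symm.trans h3))
  · exact hac (inj' _ _ (h1.symm.trans h3))
  · exact hab (inj' _ _ (h1.symm.trans h2))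
  · exact hab (inj' _ _ (h1.symm.trans h2))

/-- Connectedness of a cycle: a property that passes between any two of its edges with a common
end holds for all its edges as soon as it holds for one. -/
theorem Graph.IsCycleEdgeSet.forall_of_closed (h : (endsGraph s t).IsCycleEdgeSet C k)
    (D : E → Prop) {a : E} (ha : a ∈ C) (hDa : D a)
    (hD : ∀ b ∈ C, ∀ c ∈ C, ∀ x, Touches s t b x → Touches s t c x → D b → D c) :
    ∀ b ∈ C, D b := by
  obtain ⟨hk, v, e, hv, he, hlink, rfl⟩ := h
  obtain ⟨i, rfl⟩ := ha
  have step : ∀ j, D (e j) → D (e (j + 1)) := by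
    intro j hj
    refine hD _ ⟨j, rfl⟩ _ ⟨j + 1, rfl⟩ (v (j + 1)) ?_ ?_ hj
    · rcases hlink j with ⟨h2, h3⟩ | ⟨h2, h3⟩
      exacts [Or.inr h3, Or.inl h2]
    · rcases hlink (j + 1) with ⟨h2, h3⟩ | ⟨h2, h3⟩
      exacts [Or.inl h2, Or.inr h3]
  have all : ∀ n : ℕ, D (e (i + n)) := by
    intro n
    induction n with
    | zero => simpa using hDa
    | succ n ih => simpa [add_assoc] using step _ ih
  rintro _ ⟨j, rfl⟩
  have : NeZero k := ⟨hk.ne'⟩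
  have := all (j - i).val
  rwa [ZMod.natCast_zmod_val, add_sub_cancel] at this

end Cycle

/-- A loopless multigraph whose cycles have distinct lengths, all at least `3`, is simple and can
be transported to `Fin`. -/
theorem card_mem_simpleEdgeCounts {V E : Type*} [Fintype V] [Fintype E] (s t : E → V)
    (h3 : ∀ C k, (endsGraph s t).IsCycleEdgeSet C k → 3 ≤ k)
    (hd : (endsGraph s t).DistinctCycleLengths) :
    Fintype.card E ∈ simpleEdgeCounts (Fintype.card V) := by
  let φ := Fintype.equivFin V
  let ψ := Fintype.equivFin E
  let s' : Fin (Fintype.card E) → Fin (Fintype.card V) := fun a => φ (s (ψ.symm a))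
  let t' : Fin (Fintype.card E) → Fin (Fintype.card V) := fun a => φ (t (ψ.symm a))
  have pull : ∀ C k, (endsGraph s' t').IsCycleEdgeSet C k →
      (endsGraph s t).IsCycleEdgeSet (ψ ⁻¹' C) k := by
    rintro C k ⟨hk, v, e, hv, he, hlink, rfl⟩
    refine ⟨hk, fun i => φ.symm (v i), fun i => ψ.symm (e i), φ.symm.injective.comp hv,
      ψ.symm.injective.comp he, fun i => ?_, ?_⟩
    · rcases hlink i with ⟨h2, h3⟩ | ⟨h2, h3⟩
      · exact Or.inl ⟨by simp [← h2, s'], by simp [← h3, t']⟩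
      · exact Or.inr ⟨by simp [← h2, s'], by simp [← h3, t']⟩
    · ext b
      simp only [Set.mem_range, Set.mem_preimage]
      exact exists_congr fun i => ψ.symm_apply_eq
  have h3' : ∀ C k, (endsGraph s' t').IsCycleEdgeSet C k → 3 ≤ k := fun C k h => h3 _ _ (pull C k h)
  have loopless : ∀ a x, ¬ (endsGraph s' t').IsLink a x x := fun a x h => by
    have := h3' _ _ (Graph.isCycleEdgeSet_loop h)
    omega
  refine ⟨endsGraph s' t', rfl, rfl, ?_, ?_⟩
  · refine { not_isLoopAt := fun a x h => loopless a x h, eq_of_isLink := fun a b x y ha hb => ?_ }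
    by_contra hab
    have hxy : x ≠ y := by
      rintro rfl
      exact loopless a x ha
    have := h3' _ _ (Graph.isCycleEdgeSet_pair hab hxy ha hb)
    omega
  · intro C D k hC hD
    have := hd _ _ _ (pull C k hC) (pull D k hD)
    exact ψ.surjective.preimage_injective this

/-! ### Subdivisions -/

section Subdivision

variable {A B : Type*} (u w : A → B) (l : A → ℕ)

/-- The first end of the `k`-th edge of the path replacing `a`: a base vertex if `k = 0`, and the
inner vertex of index `k - 1` of the path otherwise. -/
def subdivStart (e : Σ a, Fin (l a)) : B ⊕ (Σ a, Fin (l a - 1)) :=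
  if h : e.2.val = 0 then Sum.inl (u e.1) else Sum.inr ⟨e.1, e.2.val - 1, by omega⟩

/-- The second end of the `k`-th edge of the path replacing `a`: a base vertex for the last edge,
and the inner vertex of index `k` of the path otherwise. -/
def subdivEnd (e : Σ a, Fin (l a)) : B ⊕ (Σ a, Fin (l a - 1)) :=
  if h : e.2.val + 1 = l e.1 then Sum.inl (w e.1) else Sum.inr ⟨e.1, e.2.val, by omega⟩

/-- The base multigraph in which the edge `a` joins `u a` to `w a`, with each edge `a` replaced by
a path of length `l a`; an edge with `l a = 0` is deleted. -/
abbrev subdiv : Graph (B ⊕ (Σ a, Fin (l a - 1))) (Σ a, Fin (l a)) :=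
  endsGraph (subdivStart u l) (subdivEnd w l)

variable {u w l}

theorem subdivStart_ne_subdivEnd (hl : ∀ a, u a ≠ w a) (e : Σ a, Fin (l a)) :
    subdivStart u l e ≠ subdivEnd w l e := by
  unfold subdivStart subdivEnd
  split_ifs with h1 h2 h2
  · simpa using hl e.1
  · simp
  · simp
  · simp only [ne_eq, Sum.inr.injEq, Sigma.mk.injEq, heq_eq_eq, true_and, Fin.mk.injEq]
    omega

theorem touches_inl {e : Σ a, Fin (l a)} {x : B}
    (h : Touches (subdivStart u l) (subdivEnd w l) e (Sum.inl x)) : u e.1 = x ∨ w e.1 = x := by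
  unfold Touches subdivStart subdivEnd at h
  split_ifs at h <;> simp_all

theorem touches_inr {e : Σ a, Fin (l a)} {a : A} {j : Fin (l a - 1)}
    (h : Touches (subdivStart u l) (subdivEnd w l) e (Sum.inr ⟨a, j⟩)) :
    ∃ k : Fin (l a), e = ⟨a, k⟩ ∧ (k.val = j.val ∨ k.val = j.val + 1) := by
  obtain ⟨a', k⟩ := e
  unfold Touches subdivStart subdivEnd at h
  rcases h with h | h
  · split_ifs at h with h0
    simp only [Sum.inr.injEq, Sigma.mk.injEq] at h
    obtain ⟨rfl, h⟩ := h
    obtain rfl := eq_of_heq h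
    exact ⟨k, rfl, Or.inr (by simp only at h0 ⊢; omega)⟩
  · split_ifs at h with h0
    simp only [Sum.inr.injEq, Sigma.mk.injEq] at h
    obtain ⟨rfl, h⟩ := h
    obtain rfl := eq_of_heq h
    exact ⟨k, rfl, Or.inl rfl⟩

variable {C : Set (Σ a, Fin (l a))} {k : ℕ}

/-- A cycle contains a whole path of the subdivision as soon as it contains one of its edges. -/
theorem Graph.IsCycleEdgeSet.subdiv_mem (h : (subdiv u w l).IsCycleEdgeSet C k)
    (hl : ∀ a, u a ≠ w a) {a : A} {i : Fin (l a)} (hi : (⟨a, i⟩ : Σ a, Fin (l a)) ∈ C)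
    (j : Fin (l a)) : (⟨a, j⟩ : Σ a, Fin (l a)) ∈ C := by
  -- The inner vertex between the consecutive edges `m` and `m + 1` has no further edges.
  have step : ∀ m (hm : m + 1 < l a),
      ((⟨a, m, by omega⟩ : Σ a, Fin (l a)) ∈ C ↔ (⟨a, m + 1, hm⟩ : Σ a, Fin (l a)) ∈ C) := by
    intro m hm
    constructor
    · intro hmC
      obtain ⟨b, hb, hne, ht⟩ := h.exists_other (subdivStart_ne_subdivEnd hl) hmC
        (x := Sum.inr ⟨a, m, by omega⟩) (Or.inr (by
          unfold subdivEnd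
          rw [dif_neg (by simp only; omega)]))
      obtain ⟨k', rfl, hk | hk⟩ := touches_inr ht
      · exact absurd (by congr; exact Fin.ext hk) hne
      · convert hb using 2
        exact Fin.ext hk.symm
    · intro hmC
      obtain ⟨b, hb, hne, ht⟩ := h.exists_other (subdivStart_ne_subdivEnd hl) hmC
        (x := Sum.inr ⟨a, m, by omega⟩) (Or.inl (by
          unfold subdivStart
          rw [dif_neg (by simp only; omega)]; rfl))
      obtain ⟨k', rfl, hk | hk⟩ := touches_inr ht
      · convert hb using 2
        exact Fin.ext hk.symm
      · exact absurd (by congr; exact Fin.ext hk) hne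
  have zero : ∀ m (hm : m < l a),
      ((⟨a, m, hm⟩ : Σ a, Fin (l a)) ∈ C ↔ (⟨a, 0, by omega⟩ : Σ a, Fin (l a)) ∈ C) := by
    intro m
    induction m with
    | zero => exact fun _ => Iff.rfl
    | succ m ih => exact fun hm => (step m hm).symm.trans (ih (by omega))
  exact (zero j j.2).2 ((zero i i.2).1 hi)

theorem Graph.IsCycleEdgeSet.subdiv_exists_other (h : (subdiv u w l).IsCycleEdgeSet C k)
    (hl : ∀ a, u a ≠ w a) {e : Σ a, Fin (l a)} (he : e ∈ C) {x : B} (hx : u e.1 = x ∨ w e.1 = x) :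
    ∃ e' ∈ C, e'.1 ≠ e.1 ∧ (u e'.1 = x ∨ w e'.1 = x) := by
  obtain ⟨a, i⟩ := e
  have hpos : 0 < l a := i.pos
  have aux : ∀ f : Fin (l a), Touches (subdivStart u l) (subdivEnd w l) ⟨a, f⟩ (Sum.inl x) →
      (∀ g : Fin (l a), Touches (subdivStart u l) (subdivEnd w l) ⟨a, g⟩ (Sum.inl x) → g = f) →
      ∃ e' ∈ C, e'.1 ≠ a ∧ (u e'.1 = x ∨ w e'.1 = x) := by
    intro f hf huniq
    obtain ⟨⟨a', j⟩, hb, hne, ht⟩ :=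
      h.exists_other (subdivStart_ne_subdivEnd hl) (h.subdiv_mem hl he f) hf
    refine ⟨_, hb, ?_, touches_inl ht⟩
    rintro rfl
    exact hne (by rw [huniq j ht])
  rcases hx with rfl | rfl
  · refine aux ⟨0, hpos⟩ (Or.inl (by simp [subdivStart])) fun g hg => Fin.ext ?_
    unfold Touches subdivStart subdivEnd at hg
    have := hl a
    split_ifs at hg <;> simp_all [eq_comm]
  · refine aux ⟨l a - 1, by omega⟩ (Or.inr ?_) fun g hg => Fin.ext ?_
    · unfold subdivEnd
      rw [dif_pos (by simp only; omega)]
    · unfold Touches subdivStart subdivEnd at hg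
      have := hl a
      split_ifs at hg <;> simp_all [eq_comm]

theorem exists_touches_inl {a : A} (hpos : 0 < l a) {x : B} (hx : u a = x ∨ w a = x) :
    ∃ i : Fin (l a), Touches (subdivStart u l) (subdivEnd w l) ⟨a, i⟩ (Sum.inl x) := by
  rcases hx with rfl | rfl
  · exact ⟨⟨0, hpos⟩, Or.inl (by simp [subdivStart])⟩
  · refine ⟨⟨l a - 1, by omega⟩, Or.inr ?_⟩
    unfold subdivEnd
    rw [dif_pos (by simp only; omega)]

theorem Graph.IsCycleEdgeSet.subdiv_not_three (h : (subdiv u w l).IsCycleEdgeSet C k)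
    (hl : ∀ a, u a ≠ w a) {a b c : Σ a, Fin (l a)} (ha : a ∈ C) (hb : b ∈ C) (hc : c ∈ C)
    (hab : a.1 ≠ b.1) (hac : a.1 ≠ c.1) (hbc : b.1 ≠ c.1) {x : B} (hxa : u a.1 = x ∨ w a.1 = x)
    (hxb : u b.1 = x ∨ w b.1 = x) (hxc : u c.1 = x ∨ w c.1 = x) : False := by
  obtain ⟨i, hi⟩ := exists_touches_inl a.2.pos hxa
  obtain ⟨j, hj⟩ := exists_touches_inl b.2.pos hxb
  obtain ⟨m, hm⟩ := exists_touches_inl c.2.pos hxc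
  refine h.not_three (h.subdiv_mem hl ha i) (h.subdiv_mem hl hb j) (h.subdiv_mem hl hc m)
    ?_ ?_ ?_ hi hj hm
  · exact fun hh => hab (Sigma.mk.inj_iff.1 hh).1
  · exact fun hh => hac (Sigma.mk.inj_iff.1 hh).1
  · exact fun hh => hbc (Sigma.mk.inj_iff.1 hh).1

/-- The length of a cycle of a subdivision is the total length of the paths that it uses. -/
theorem Graph.IsCycleEdgeSet.subdiv_length (h : (subdiv u w l).IsCycleEdgeSet C k) (S : Finset A)
    (hS : ∀ e : Σ a, Fin (l a), e ∈ C ↔ e.1 ∈ S) : k = ∑ a ∈ S, l a := by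
  have : C = ((S.sigma fun _ => Finset.univ : Finset (Σ a, Fin (l a))) : Set (Σ a, Fin (l a))) := by
    ext e
    simp [hS]
  rw [← h.ncard_eq, this, Set.ncard_coe_finset, Finset.card_sigma]
  simp

end Subdivision

/-! ### Blocks shaped like a wheel with four spokes -/

/-- First ends of the edges of a block, whose vertices are the hub `0` and the rim `1, 2, 3, 4`:
the edges `0, 1, 2, 3` are the spokes, `4, 5, 6, 7` are the rim edges, and `8` is the bridge that
leads from the hub to the root of the whole graph. -/
def wheelStart : Fin 9 → Fin 5 := ![0, 0, 0, 0, 1, 2, 3, 4, 0]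

/-- Second ends of the edges of a block; `none` stands for the root. -/
def wheelEnd : Fin 9 → Option (Fin 5) :=
  ![some 1, some 2, some 3, some 4, some 2, some 3, some 4, some 1, none]

/-- The edge sets of the thirteen cycles of the wheel: for any two spokes the two cycles through
them, and the rim. -/
def wheelCycle : Fin 13 → Finset (Fin 9) :=
  ![{0, 1, 4}, {1, 2, 5}, {0, 2, 4, 5}, {2, 3, 6}, {1, 3, 5, 6}, {0, 3, 4, 5, 6}, {0, 3, 7},
    {1, 3, 4, 7}, {2, 3, 4, 5, 7}, {0, 2, 6, 7}, {1, 2, 4, 6, 7}, {0, 1, 5, 6, 7}, {4, 5, 6, 7}]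

/-- The edge `a` of a block ends at the vertex `b`. -/
abbrev WheelInc (a : Fin 9) (b : Fin 5) : Prop := wheelStart a = b ∨ wheelEnd a = some b

set_option maxRecDepth 100000 in
/-- Being of degree `0` or `2` everywhere in a block forces a set of its edges to be empty or one of
the thirteen cycles; in particular the bridge is not used. -/
theorem eq_empty_or_eq_wheelCycle : ∀ S : Finset (Fin 9),
    (∀ b : Fin 5, (S.filter (WheelInc · b)).card = 0 ∨ (S.filter (WheelInc · b)).card = 2) →
    S = ∅ ∨ ∃ c, S = wheelCycle c := by
  decide +kernel

theorem eight_notMem_wheelCycle : ∀ c, 8 ∉ wheelCycle c := by decide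

section Blocks

variable {I : Type*}

/-- First ends of the edges of a union of blocks indexed by `I`. -/
def blockStart (a : I × Fin 9) : Option (I × Fin 5) := some (a.1, wheelStart a.2)

/-- Second ends of the edges of a union of blocks, all attached by bridges to the root `none`. -/
def blockEnd (a : I × Fin 9) : Option (I × Fin 5) := (wheelEnd a.2).map (Prod.mk a.1)

theorem blockStart_ne_blockEnd (a : I × Fin 9) : blockStart a ≠ blockEnd a := by
  obtain ⟨i, a⟩ := a
  have h : ∀ a, some (wheelStart a) ≠ wheelEnd a := by decide
  have := h a
  unfold blockStart blockEnd
  cases hw : wheelEnd a with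
  | none => simp
  | some b =>
    rw [hw] at this
    simpa using this

theorem blockInc_iff {a : I × Fin 9} {i : I} {b : Fin 5} :
    (blockStart a = some (i, b) ∨ blockEnd a = some (i, b)) ↔ a.1 = i ∧ WheelInc a.2 b := by
  obtain ⟨j, a⟩ := a
  unfold blockStart blockEnd WheelInc
  cases hw : wheelEnd a with
  | none => simp
  | some c => simp only [Option.map_some, Option.some.injEq, Prod.mk.injEq]; tauto

theorem eq_eight_of_blockEnd_eq_none {a : I × Fin 9} (h : blockEnd a = none) : a.2 = 8 := by
  have key : ∀ a, wheelEnd a = none → a = 8 := by decide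
  exact key _ (by simpa [blockEnd] using h)

/-- Every cycle of a subdivided union of blocks comes from one of the thirteen cycles of one
block. -/
theorem exists_wheelCycle {l : I × Fin 9 → ℕ} {C : Set (Σ a, Fin (l a))} {k : ℕ}
    (h : (subdiv blockStart blockEnd l).IsCycleEdgeSet C k) :
    ∃ i c, (∀ a ∈ wheelCycle c, 0 < l (i, a)) ∧
      (∀ e : Σ a, Fin (l a), e ∈ C ↔ e.1.1 = i ∧ e.1.2 ∈ wheelCycle c) ∧
      k = ∑ a ∈ wheelCycle c, l (i, a) := by
  classical
  let S : I → Finset (Fin 9) := fun i => Finset.univ.filter fun a => ∃ e ∈ C, e.1 = (i, a)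
  have hS : ∀ i a, a ∈ S i ↔ ∃ e ∈ C, e.1 = (i, a) := fun i a => by simp [S]
  have hne := blockStart_ne_blockEnd (I := I)
  have hcl : ∀ i, S i = ∅ ∨ ∃ c, S i = wheelCycle c := by
    intro i
    refine eq_empty_or_eq_wheelCycle (S i) fun b => ?_
    have h1 : ((S i).filter (WheelInc · b)).card ≠ 1 := by
      intro h1
      obtain ⟨a, ha⟩ := Finset.card_eq_one.1 h1
      have haF : a ∈ (S i).filter (WheelInc · b) := by simp [ha]
      obtain ⟨haS, hab⟩ := Finset.mem_filter.1 haF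
      obtain ⟨e, he, hea⟩ := (hS _ _).1 haS
      obtain ⟨e', he', hne', hinc⟩ := h.subdiv_exists_other hne he (x := some (i, b))
        (blockInc_iff.2 (by simpa [hea] using hab))
      obtain ⟨hi, hb⟩ := blockInc_iff.1 hinc
      have : e'.1.2 ∈ (S i).filter (WheelInc · b) :=
        Finset.mem_filter.2 ⟨(hS _ _).2 ⟨e', he', Prod.ext hi rfl⟩, hb⟩
      rw [ha, Finset.mem_singleton] at this
      exact hne' (by rw [hea]; exact Prod.ext hi this)
    have h2 : ((S i).filter (WheelInc · b)).card ≤ 2 := by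
      by_contra! h3
      obtain ⟨a₁, a₂, a₃, h₁, h₂, h₃, h12, h13, h23⟩ := Finset.two_lt_card_iff.1 h3
      obtain ⟨h₁, i₁⟩ := Finset.mem_filter.1 h₁
      obtain ⟨h₂, i₂⟩ := Finset.mem_filter.1 h₂
      obtain ⟨h₃, i₃⟩ := Finset.mem_filter.1 h₃
      obtain ⟨e₁, he₁, q₁⟩ := (hS _ _).1 h₁
      obtain ⟨e₂, he₂, q₂⟩ := (hS _ _).1 h₂
      obtain ⟨e₃, he₃, q₃⟩ := (hS _ _).1 h₃
      exact h.subdiv_not_three hne he₁ he₂ he₃ (by simpa [q₁, q₂] using h12)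
        (by simpa [q₁, q₃] using h13) (by simpa [q₂, q₃] using h23) (x := some (i, b))
        (blockInc_iff.2 (by simpa [q₁] using i₁)) (blockInc_iff.2 (by simpa [q₂] using i₂))
        (blockInc_iff.2 (by simpa [q₃] using i₃))
    omega
  -- Without bridges in the cycle, edges with a common end lie in the same block.
  have h8 : ∀ e ∈ C, e.1.2 ≠ 8 := by
    intro e he he8
    have hmem : (8 : Fin 9) ∈ S e.1.1 := (hS _ _).2 ⟨e, he, Prod.ext rfl he8⟩
    rcases hcl e.1.1 with h0 | ⟨c, hc⟩
    · simp [h0] at hmem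
    · exact eight_notMem_wheelCycle c (hc ▸ hmem)
  obtain ⟨e₀, he₀⟩ := h.nonempty
  have hone : ∀ e ∈ C, e.1.1 = e₀.1.1 := by
    refine h.forall_of_closed (fun e => e.1.1 = e₀.1.1) he₀ rfl ?_
    rintro b hb c hc (x | ⟨a, j⟩) hbx hcx hDb
    · have end_ne : ∀ e ∈ C, blockEnd e.1 ≠ none := fun e he h0 =>
        h8 e he (eq_eight_of_blockEnd_eq_none h0)
      cases x with
      | none =>
        rcases touches_inl hbx with h0 | h0
        · simp [blockStart] at h0
        · exact absurd h0 (end_ne b hb)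
      | some x =>
        have hb' := (blockInc_iff.1 (touches_inl hbx)).1
        have hc' := (blockInc_iff.1 (touches_inl hcx)).1
        rw [hc', ← hb', hDb]
    · obtain ⟨_, rfl, -⟩ := touches_inr hbx
      obtain ⟨_, rfl, -⟩ := touches_inr hcx
      exact hDb
  rcases hcl e₀.1.1 with h0 | ⟨c, hc⟩
  · have : e₀.1.2 ∈ S e₀.1.1 := (hS _ _).2 ⟨e₀, he₀, rfl⟩
    simp [h0] at this
  have hmem : ∀ e : Σ a, Fin (l a), e ∈ C ↔ e.1.1 = e₀.1.1 ∧ e.1.2 ∈ wheelCycle c := by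
    intro e
    constructor
    · intro he
      have := hone e he
      refine ⟨this, ?_⟩
      rw [← hc]
      exact (hS _ _).2 ⟨e, he, Prod.ext this rfl⟩
    · rintro ⟨hi, ha⟩
      rw [← hc] at ha
      obtain ⟨e', he', hee⟩ := (hS _ _).1 ha
      obtain ⟨⟨j, a⟩, x⟩ := e
      obtain ⟨a', x'⟩ := e'
      simp only at hi hee
      subst hi
      subst hee
      exact h.subdiv_mem hne he' x
  refine ⟨e₀.1.1, c, ?_, hmem, ?_⟩
  · intro a ha
    rw [← hc] at ha
    obtain ⟨e, -, hea⟩ := (hS _ _).1 ha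
    rw [← hea]
    exact e.2.pos
  · have := h.subdiv_length ((wheelCycle c).map ⟨Prod.mk e₀.1.1, fun _ _ => by simp⟩) ?_
    · rw [Finset.sum_map] at this
      exact this
    · intro e
      rw [hmem e]
      simp only [Finset.mem_map]
      constructor
      · rintro ⟨h1, h2⟩
        exact ⟨_, h2, Prod.ext h1.symm rfl⟩
      · rintro ⟨a, ha, hae⟩
        rw [← hae]
        exact ⟨rfl, ha⟩

/-- Blocks with paths of lengths `l i a` that have cycles of pairwise distinct lengths, at least
`3`, give a simple graph with distinct cycle lengths. A block with a path of length `0` only has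
the cycles that avoid this path. -/
theorem sum_mem_simpleEdgeCounts [Fintype I] (l : I → Fin 9 → ℕ)
    (h3 : ∀ i c, (∀ a ∈ wheelCycle c, 0 < l i a) → 3 ≤ ∑ a ∈ wheelCycle c, l i a)
    (hinj : ∀ i c j d, (∀ a ∈ wheelCycle c, 0 < l i a) → (∀ a ∈ wheelCycle d, 0 < l j a) →
      ∑ a ∈ wheelCycle c, l i a = ∑ a ∈ wheelCycle d, l j a → i = j ∧ c = d) :
    ∑ i, ∑ a, l i a ∈
      simpleEdgeCounts (1 + 5 * Fintype.card I + ∑ i, ∑ a, (l i a - 1)) := by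
  have key := card_mem_simpleEdgeCounts
    (subdivStart blockStart fun a : I × Fin 9 => l a.1 a.2)
    (subdivEnd blockEnd fun a : I × Fin 9 => l a.1 a.2) ?_ ?_
  · simp only [Fintype.card_sigma, Fintype.card_fin, Fintype.card_sum, Fintype.card_option,
      Fintype.card_prod, Fintype.sum_prod_type] at key
    convert key using 2
    ring
  · intro C k h
    obtain ⟨i, c, hpos, -, rfl⟩ := exists_wheelCycle h
    exact h3 i c hpos
  · intro C D k hC hD
    obtain ⟨i, c, hpos, hmem, hk⟩ := exists_wheelCycle hC
    obtain ⟨j, d, hpos', hmem', hk'⟩ := exists_wheelCycle hD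
    obtain ⟨rfl, rfl⟩ := hinj i c j d hpos hpos' (hk.symm.trans hk')
    ext e
    rw [hmem, hmem']

end Blocks

/-! ### The lengths of the paths in the blocks -/

/-- A block whose only cycle, through the first two spokes, has length `j + 3`. -/
def singleLen (j : ℕ) : Fin 9 → ℕ := ![1, 1, 1, 1, j + 1, 0, 0, 0, 1]

/-- A theta graph. Its three paths lead from the hub to the second rim vertex, the first and the
third of them over a neighbouring rim vertex by a last edge of length `1`. Their lengths are `82 *
z + 2 * m`, `110 * z + 2 * m` and `138 * z + 2 * m`, with corrections that depend on `d` and make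
the sum of any two of them cover all residues modulo `4`. -/
def thetaLen (z : ℕ) (d : Fin 4) (m : ℕ) : Fin 9 → ℕ :=
  ![82 * z + 2 * m + ![0, 0, 2, 1] d - 1, 110 * z + 2 * m + ![0, 1, 0, 2] d,
    138 * z + 2 * m + ![0, 2, 1, 0] d - 1, 1, 1, 1, 0, 0, 1]

/-- A subdivided wheel. The corrections that depend on `d` make the lengths of the cycles with two
spokes cover all residues modulo `4`. They were found by a search, subject to the length of each
cycle staying in its interval. The path `5` is the one that absorbs twice the variation of two
spokes, so that the cycles through it get shorter as `m` grows. -/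
def wheelLen (z : ℕ) (d : Fin 4) (h : Fin 2) (m : ℕ) : Fin 9 → ℕ :=
  ![90 * z + 2 * m + 6 * z * h + ![1, 4, 1, 3] d, 126 * z + 2 * m + 6 * z * h + ![0, 2, 4, 5] d - 1,
    78 * z + 2 * m + 6 * z * h + ![1, 2, 0, 0] d, 114 * z + 2 * m + 6 * z * h + ![3, 1, 0, 3] d,
    132 * z + ![0, 0, 2, 0] d, 84 * z + h + ![3, 2, 3, 0] d - 11 - 8 * m,
    132 * z + ![4, 2, 6, 0] d - 3, 96 * z + ![0, 1, 0, 1] d - 1, 1]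

/-- A tree, the four spokes and a bridge. The bridge of length `p + 1` serves to adjust the
number of vertices. -/
def padLen (p : ℕ) : Fin 9 → ℕ := ![1, 1, 1, 1, 0, 0, 0, 0, p + 1]

theorem sum_wheelCycle (f : Fin 9 → ℕ) (c : Fin 13) : ∑ a ∈ wheelCycle c, f a =
    ![f 0 + f 1 + f 4, f 1 + f 2 + f 5, f 0 + f 2 + f 4 + f 5, f 2 + f 3 + f 6,
      f 1 + f 3 + f 5 + f 6, f 0 + f 3 + f 4 + f 5 + f 6, f 0 + f 3 + f 7, f 1 + f 3 + f 4 + f 7,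
      f 2 + f 3 + f 4 + f 5 + f 7, f 0 + f 2 + f 6 + f 7, f 1 + f 2 + f 4 + f 6 + f 7,
      f 0 + f 1 + f 5 + f 6 + f 7, f 4 + f 5 + f 6 + f 7] c := by
  fin_cases c <;> simp [wheelCycle] <;> ring

theorem not_forall_pos_padLen (p : ℕ) (c : Fin 13) : ¬ ∀ a ∈ wheelCycle c, 0 < padLen p a := by
  have key : ∀ c, ∃ a ∈ wheelCycle c, a = 4 ∨ a = 5 ∨ a = 6 ∨ a = 7 := by decide
  obtain ⟨a, ha, h⟩ := key c
  intro hpos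
  have := hpos a ha
  rcases h with rfl | rfl | rfl | rfl <;> simp [padLen] at this

theorem singleLen_cycle (j : ℕ) (c : Fin 13) (h : ∀ a ∈ wheelCycle c, 0 < singleLen j a) :
    c = 0 ∧ ∑ a ∈ wheelCycle c, singleLen j a = j + 3 := by
  have key : ∀ c, c = 0 ∨ ∃ a ∈ wheelCycle c, a = 5 ∨ a = 6 ∨ a = 7 := by decide
  rcases key c with rfl | ⟨a, ha, h'⟩
  · refine ⟨rfl, ?_⟩
    simp [sum_wheelCycle, singleLen]
    omega
  · have := h a ha
    rcases h' with rfl | rfl | rfl <;> simp [singleLen] at this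

/-- The place of the length of a cycle of a theta graph among three intervals; only the cycles
`0, 1, 2` exist in a theta graph. -/
def thetaCell : Fin 13 → ℕ := ![0, 2, 1, 0, 0, 0, 0, 0, 0, 0, 0, 0, 0]

/-- The contribution of the corrections for `d` to the length of a cycle of a theta graph, which
determines `d`. -/
def thetaResidue : Fin 13 → Fin 4 → ℕ :=
  ![![0, 1, 2, 3], ![0, 3, 1, 2], ![0, 2, 3, 1], 0, 0, 0, 0, 0, 0, 0, 0, 0, 0]

theorem thetaLen_cycle {z : ℕ} (hz : 1 ≤ z) (d : Fin 4) (m : ℕ) (c : Fin 13)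
    (h : ∀ a ∈ wheelCycle c, 0 < thetaLen z d m a) :
    (c = 0 ∨ c = 1 ∨ c = 2) ∧ ∑ a ∈ wheelCycle c, thetaLen z d m a =
      192 * z + 28 * z * thetaCell c + 4 * m + thetaResidue c d := by
  have key : ∀ c : Fin 13, c = 0 ∨ c = 1 ∨ c = 2 ∨ ∃ a ∈ wheelCycle c, a = 6 ∨ a = 7 := by decide
  rcases key c with rfl | rfl | rfl | ⟨a, ha, h'⟩
  · refine ⟨by decide, ?_⟩
    fin_cases d <;> simp [sum_wheelCycle, thetaLen, thetaCell, thetaResidue] <;> omega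
  · refine ⟨by decide, ?_⟩
    fin_cases d <;> simp [sum_wheelCycle, thetaLen, thetaCell, thetaResidue] <;> omega
  · refine ⟨by decide, ?_⟩
    fin_cases d <;> simp [sum_wheelCycle, thetaLen, thetaCell, thetaResidue] <;> omega
  · have := h a ha
    rcases h' with rfl | rfl <;> simp [thetaLen] at this

/-- The place of the length of a cycle of a wheel among thirteen intervals. -/
def wheelCell : Fin 13 → ℕ := ![3, 0, 4, 2, 7, 11, 1, 8, 9, 5, 12, 10, 6]

/-- The contribution, up to sign, of the corrections for `d` to the length of a cycle of a wheel.
It is to be subtracted for the cycles through the path `5`. It determines `d` by its residue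
modulo `4`, and for the rim by its residue modulo `8`, where it is even. -/
def wheelResidue : Fin 13 → Fin 4 → ℕ :=
  ![![0, 5, 6, 7], ![8, 6, 5, 7], ![6, 3, 5, 8], ![5, 2, 3, 0], ![5, 8, 2, 7], ![3, 5, 2, 8],
    ![3, 5, 0, 6], ![1, 2, 4, 7], ![5, 6, 7, 8], ![2, 5, 3, 0], ![0, 2, 7, 1], ![8, 5, 2, 7],
    ![8, 10, 4, 14]]

set_option maxHeartbeats 4000000 in
/-- The lengths of the cycles of a wheel. They grow with `m` for the cycles that avoid the path `5`,
and shrink for the others, at double speed for the rim. -/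
theorem wheelLen_cycle {z : ℕ} (hz : 1 ≤ z) (d : Fin 4) (h : Fin 2) {m : ℕ} (hm : m + 2 ≤ 3 * z)
    (c : Fin 13) :
    (5 ∉ wheelCycle c ∧ ∑ a ∈ wheelCycle c, wheelLen z d h m a =
        276 * z + 24 * z * wheelCell c + 12 * z * h + 4 * m + wheelResidue c d) ∨
      (5 ∈ wheelCycle c ∧ c ≠ 12 ∧
        (∑ a ∈ wheelCycle c, wheelLen z d h m a) + 4 * m + wheelResidue c d =
          276 * z + 24 * z * wheelCell c + 12 * z * h + 12 * z + h) ∨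
      (c = 12 ∧ (∑ a ∈ wheelCycle c, wheelLen z d h m a) + 8 * m + wheelResidue c d =
          276 * z + 24 * z * wheelCell c + 24 * z + h) := by
  rw [sum_wheelCycle]
  fin_cases c
  all_goals
    first
    | refine Or.inl ⟨by decide, ?_⟩
    | refine Or.inr (Or.inl ⟨by decide, by decide, ?_⟩)
    | refine Or.inr (Or.inr ⟨rfl, ?_⟩)
  all_goals
    fin_cases d <;> fin_cases h <;> simp [wheelLen, wheelCell, wheelResidue] <;> omega

theorem wheelResidue_bounds : ∀ c d, 2 ≤ wheelResidue c d + if 5 ∈ wheelCycle c then 0 else 2 := by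
  decide

theorem wheelResidue_le : ∀ c d, wheelResidue c d ≤
    if 5 ∈ wheelCycle c then (if c = 12 then 14 else 8) else 7 := by
  decide

/-- The cycles of a wheel have lengths in the interval assigned to them. -/
theorem wheelLen_cycle_mem {z : ℕ} (hz : 1 ≤ z) (d : Fin 4) (h : Fin 2) {m : ℕ}
    (hm : m + 2 ≤ 3 * z) (c : Fin 13) :
    276 * z + 24 * z * wheelCell c ≤ ∑ a ∈ wheelCycle c, wheelLen z d h m a ∧
      ∑ a ∈ wheelCycle c, wheelLen z d h m a < 276 * z + 24 * z * wheelCell c + 24 * z := by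
  have h1 := wheelResidue_bounds c d
  have h2 := wheelResidue_le c d
  rcases wheelLen_cycle hz d h hm c with ⟨hc, h3⟩ | ⟨hc, hc', h3⟩ | ⟨rfl, h3⟩
  · rw [if_neg hc] at h1 h2
    fin_cases h <;> simp at h3 ⊢ <;> omega
  · rw [if_pos hc] at h1 h2
    rw [if_neg hc'] at h2
    fin_cases h <;> simp at h3 ⊢ <;> omega
  · have h4 : ∀ d, 3 ≤ wheelResidue 12 d := by decide
    have := h4 d
    rw [if_pos (by decide), if_pos rfl] at h2
    fin_cases h <;> simp at h3 ⊢ <;> omega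

theorem eq_of_mem_cells {q b x i j : ℕ} (hi : b + q * i ≤ x) (hi' : x < b + q * i + q)
    (hj : b + q * j ≤ x) (hj' : x < b + q * j + q) : i = j := by
  by_contra hne
  rcases Nat.lt_or_gt_of_ne hne with h | h
  · have := Nat.mul_le_mul_left q (Nat.succ_le_of_lt h)
    rw [Nat.mul_succ] at this
    omega
  · have := Nat.mul_le_mul_left q (Nat.succ_le_of_lt h)
    rw [Nat.mul_succ] at this
    omega

theorem wheelLen_cycle_injective {z : ℕ} (hz : 1 ≤ z) {d d' : Fin 4} {h h' : Fin 2} {m m' : ℕ}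
    (hm : m + 2 ≤ 3 * z) (hm' : m' + 2 ≤ 3 * z) {c c' : Fin 13}
    (heq : ∑ a ∈ wheelCycle c, wheelLen z d h m a = ∑ a ∈ wheelCycle c', wheelLen z d' h' m' a) :
    (d = d' ∧ h = h' ∧ m = m') ∧ c = c' := by
  -- The interval of the length determines the cycle, its half (for the rim, the parity) determines
  -- `h`, and the residue determines `d`.
  have hcc : c = c' := by
    have inj : Function.Injective wheelCell := by decide
    have hb := wheelLen_cycle_mem hz d h hm c
    have hb' := wheelLen_cycle_mem hz d' h' hm' c'
    rw [← heq] at hb'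
    exact inj (eq_of_mem_cells hb.1 hb.2 hb'.1 hb'.2)
  subst hcc
  refine ⟨?_, rfl⟩
  have residue : ∀ c, c ≠ 12 → ∀ d d', wheelResidue c d % 4 = wheelResidue c d' % 4 → d = d' := by
    decide
  have residue_rim : ∀ (h h' : Fin 2) (d d' : Fin 4),
      (wheelResidue 12 d + 8 - h) % 8 = (wheelResidue 12 d' + 8 - h') % 8 → d = d' ∧ h = h' := by
    decide
  have l1 := wheelResidue_bounds c d
  have l1' := wheelResidue_bounds c d'
  have l2 := wheelResidue_le c d
  have l2' := wheelResidue_le c d'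
  have w := wheelLen_cycle hz d h hm c
  have w' := wheelLen_cycle hz d' h' hm' c
  rw [← heq] at w'
  generalize ∑ a ∈ wheelCycle c, wheelLen z d h m a = x at w w'
  rcases w with ⟨hc, h3⟩ | ⟨hc, hc', h3⟩ | ⟨rfl, h3⟩ <;>
    rcases w' with ⟨hd, h4⟩ | ⟨hd, hd', h4⟩ | ⟨hd', h4⟩
  · have hc' : c ≠ 12 := by
      rintro rfl
      exact hc (by decide)
    rw [if_neg hc] at l2 l2'
    have hh : h = h' := by
      fin_cases h <;> fin_cases h' <;> simp at h3 h4 ⊢ <;> omega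
    subst hh
    have hd : d = d' := residue c hc' d d' (by omega)
    subst hd
    exact ⟨rfl, rfl, by omega⟩
  · exact absurd hd hc
  · exact absurd (hd' ▸ by decide) hc
  · exact absurd hc hd
  · rw [if_pos hc] at l1 l1' l2 l2'
    rw [if_neg hc'] at l2 l2'
    have hh : h = h' := by
      fin_cases h <;> fin_cases h' <;> simp at h3 h4 ⊢ <;> omega
    subst hh
    have hd : d = d' := residue c hc' d d' (by omega)
    subst hd
    exact ⟨rfl, rfl, by omega⟩
  · exact absurd hd' hc'
  · exact absurd (by decide) hd
  · exact absurd rfl hd'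
  · have hr : 3 ≤ wheelResidue 12 d ∧ 3 ≤ wheelResidue 12 d' := by
      have : ∀ d, 3 ≤ wheelResidue 12 d := by decide
      exact ⟨this d, this d'⟩
    have hh2 := h.2
    have hh2' := h'.2
    obtain ⟨rfl, rfl⟩ := residue_rim h h' d d' (by omega)
    exact ⟨rfl, rfl, by omega⟩

theorem thetaLen_cycle_injective {z : ℕ} (hz : 1 ≤ z) {d d' : Fin 4} {m m' : ℕ}
    (hm : m < 7 * z) (hm' : m' < 7 * z) {c c' : Fin 13}
    (hc : ∀ a ∈ wheelCycle c, 0 < thetaLen z d m a)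
    (hc' : ∀ a ∈ wheelCycle c', 0 < thetaLen z d' m' a)
    (heq : ∑ a ∈ wheelCycle c, thetaLen z d m a = ∑ a ∈ wheelCycle c', thetaLen z d' m' a) :
    (d = d' ∧ m = m') ∧ c = c' := by
  obtain ⟨h1, h2⟩ := thetaLen_cycle hz d m c hc
  obtain ⟨h1', h2'⟩ := thetaLen_cycle hz d' m' c' hc'
  have hlt : ∀ c d, thetaResidue c d < 4 := by decide
  have l1 := hlt c d
  have l2 := hlt c' d'
  have cell : ∀ c c' : Fin 13, (c = 0 ∨ c = 1 ∨ c = 2) → (c' = 0 ∨ c' = 1 ∨ c' = 2) →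
      thetaCell c = thetaCell c' → c = c' := by decide
  have residue : ∀ c : Fin 13, (c = 0 ∨ c = 1 ∨ c = 2) → ∀ d d',
      thetaResidue c d = thetaResidue c d' → d = d' := by decide
  have hcc : c = c' := cell c c' h1 h1'
    (eq_of_mem_cells (q := 28 * z) (b := 192 * z) (x := ∑ a ∈ wheelCycle c, thetaLen z d m a)
      (by omega) (by omega) (by omega) (by omega))
  subst hcc
  have hd : d = d' := residue c h1 d d' (by omega)
  subst hd
  exact ⟨⟨rfl, by omega⟩, rfl⟩

theorem thetaLen_cycle_mem {z : ℕ} (hz : 1 ≤ z) {d : Fin 4} {m : ℕ} (hm : m < 7 * z) {c : Fin 13}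
    (hc : ∀ a ∈ wheelCycle c, 0 < thetaLen z d m a) :
    192 * z ≤ ∑ a ∈ wheelCycle c, thetaLen z d m a ∧
      ∑ a ∈ wheelCycle c, thetaLen z d m a < 276 * z := by
  obtain ⟨h1, h2⟩ := thetaLen_cycle hz d m c hc
  have hlt : ∀ c d, thetaResidue c d < 4 := by decide
  have l1 := hlt c d
  have l2 : thetaCell c ≤ 2 := by
    have : ∀ c, thetaCell c ≤ 2 := by decide
    exact this c
  have l3 := Nat.mul_le_mul_left (28 * z) l2
  omega

/-! ### The union of all blocks -/

/-- Indices of the blocks: one tree for padding, the blocks with a single cycle, the theta graphs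
and the wheels. -/
abbrev BlockIndex (z : ℕ) : Type :=
  Option (Fin (192 * z - 3) ⊕ (Fin 4 × Fin (7 * z)) ⊕ (Fin 4 × Fin 2 × Fin (3 * z - 1)))

/-- The lengths of the paths in all the blocks. -/
def blockLen (z p : ℕ) : BlockIndex z → Fin 9 → ℕ
  | none => padLen p
  | some (Sum.inl j) => singleLen j
  | some (Sum.inr (Sum.inl (d, m))) => thetaLen z d m
  | some (Sum.inr (Sum.inr (d, h, m))) => wheelLen z d h m

theorem three_le_blockLen_cycle {z : ℕ} (hz : 1 ≤ z) (p : ℕ) (i : BlockIndex z) (c : Fin 13)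
    (hc : ∀ a ∈ wheelCycle c, 0 < blockLen z p i a) :
    3 ≤ ∑ a ∈ wheelCycle c, blockLen z p i a := by
  rcases i with _ | j | ⟨d, m⟩ | ⟨d, h, m⟩
  · exact absurd hc (not_forall_pos_padLen p c)
  · have := (singleLen_cycle j c hc).2
    simp only [blockLen]
    omega
  · have := (thetaLen_cycle_mem hz m.2 hc).1
    simp only [blockLen]
    omega
  · have := (wheelLen_cycle_mem hz d h (m := m) (by omega) c).1
    simp only [blockLen]
    omega

theorem blockLen_cycle_injective {z : ℕ} (hz : 1 ≤ z) (p : ℕ) (i : BlockIndex z) (c : Fin 13)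
    (i' : BlockIndex z) (c' : Fin 13) (hc : ∀ a ∈ wheelCycle c, 0 < blockLen z p i a)
    (hc' : ∀ a ∈ wheelCycle c', 0 < blockLen z p i' a)
    (heq : ∑ a ∈ wheelCycle c, blockLen z p i a = ∑ a ∈ wheelCycle c', blockLen z p i' a) :
    i = i' ∧ c = c' := by
  rcases i with _ | j | ⟨d, m⟩ | ⟨d, h, m⟩
  · exact absurd hc (not_forall_pos_padLen p c)
  all_goals
    rcases i' with _ | j' | ⟨d', m'⟩ | ⟨d', h', m'⟩
    · exact absurd hc' (not_forall_pos_padLen p c')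
    all_goals simp only [blockLen] at heq hc hc'
  · obtain ⟨rfl, h1⟩ := singleLen_cycle j c hc
    obtain ⟨rfl, h2⟩ := singleLen_cycle j' c' hc'
    have : j = j' := Fin.ext (by omega)
    exact ⟨by rw [this], rfl⟩
  · have h1 := (singleLen_cycle j c hc).2
    have h2 := thetaLen_cycle_mem hz m'.2 hc'
    omega
  · have h1 := (singleLen_cycle j c hc).2
    have h2 := wheelLen_cycle_mem hz d' h' (m := m') (by omega) c'
    omega
  · have h1 := (singleLen_cycle j' c' hc').2
    have h2 := thetaLen_cycle_mem hz m.2 hc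
    omega
  · obtain ⟨⟨rfl, h⟩, rfl⟩ := thetaLen_cycle_injective hz m.2 m'.2 hc hc' heq
    have : m = m' := Fin.ext h
    exact ⟨by rw [this], rfl⟩
  · have h1 := thetaLen_cycle_mem hz m.2 hc
    have h2 := wheelLen_cycle_mem hz d' h' (m := m') (by omega) c'
    omega
  · have h1 := (singleLen_cycle j' c' hc').2
    have h2 := wheelLen_cycle_mem hz d h (m := m) (by omega) c
    omega
  · have h1 := thetaLen_cycle_mem hz m'.2 hc'
    have h2 := wheelLen_cycle_mem hz d h (m := m) (by omega) c
    omega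
  · obtain ⟨⟨rfl, rfl, h⟩, rfl⟩ :=
      wheelLen_cycle_injective hz (m := m) (m' := m') (by omega) (by omega) heq
    have : m = m' := Fin.ext h
    exact ⟨by rw [this], rfl⟩

/-! ### Numbers of vertices and edges -/

theorem card_blockIndex (z : ℕ) :
    Fintype.card (BlockIndex z) = 192 * z - 3 + (28 * z + 8 * (3 * z - 1)) + 1 := by
  simp only [BlockIndex, Fintype.card_option, Fintype.card_sum, Fintype.card_prod, Fintype.card_fin]
  omega

theorem sum_padLen (p : ℕ) : ∑ a, padLen p a = ∑ a, (padLen p a - 1) + 5 := by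
  simp [Fin.sum_univ_succ, padLen]
  omega

theorem sum_padLen_sub (p : ℕ) : ∑ a, (padLen p a - 1) = p := by
  simp [Fin.sum_univ_succ, padLen]

theorem sum_singleLen (j : ℕ) : ∑ a, singleLen j a = ∑ a, (singleLen j a - 1) + 6 := by
  simp [Fin.sum_univ_succ, singleLen]
  omega

theorem sum_singleLen_sub (j : ℕ) : ∑ a, (singleLen j a - 1) = j := by
  simp [Fin.sum_univ_succ, singleLen]

theorem sum_thetaLen {z : ℕ} (hz : 1 ≤ z) (d : Fin 4) (m : ℕ) :
    ∑ a, thetaLen z d m a = ∑ a, (thetaLen z d m a - 1) + 7 := by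
  simp only [Fin.sum_univ_succ, thetaLen]
  fin_cases d <;> simp <;> omega

theorem sum_thetaLen_sub_le {z : ℕ} (hz : 1 ≤ z) (d : Fin 4) (m : ℕ) :
    ∑ a, (thetaLen z d m a - 1) ≤ 330 * z + 6 * m := by
  simp only [Fin.sum_univ_succ, thetaLen]
  fin_cases d <;> simp <;> omega

theorem sum_wheelLen {z : ℕ} (hz : 1 ≤ z) (d : Fin 4) (h : Fin 2) {m : ℕ} (hm : m + 2 ≤ 3 * z) :
    ∑ a, wheelLen z d h m a = ∑ a, (wheelLen z d h m a - 1) + 9 := by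
  simp only [Fin.sum_univ_succ, wheelLen]
  fin_cases d <;> simp <;> omega

theorem sum_wheelLen_sub_le {z : ℕ} (hz : 1 ≤ z) (d : Fin 4) (h : Fin 2) {m : ℕ}
    (hm : m + 2 ≤ 3 * z) : ∑ a, (wheelLen z d h m a - 1) ≤ 852 * z + 24 * z * h := by
  simp only [Fin.sum_univ_succ, wheelLen]
  fin_cases d <;> fin_cases h <;> simp <;> omega

/-- The number of inner vertices of all the paths except those of the padding tree. -/
def innerCount (z : ℕ) : ℕ :=
  ∑ j : Fin (192 * z - 3), ∑ a, (singleLen j a - 1) +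
    (∑ d : Fin 4, ∑ m : Fin (7 * z), ∑ a, (thetaLen z d m a - 1) +
      ∑ d : Fin 4, ∑ h : Fin 2, ∑ m : Fin (3 * z - 1), ∑ a, (wheelLen z d h m a - 1))

theorem sum_blockLen_sub (z p : ℕ) :
    ∑ i, ∑ a, (blockLen z p i a - 1) = p + innerCount z := by
  simp only [BlockIndex, Fintype.sum_option, Fintype.sum_sum_type, Fintype.sum_prod_type, blockLen,
    sum_padLen_sub, innerCount]

theorem sum_blockLen {z : ℕ} (hz : 1 ≤ z) (p : ℕ) :
    ∑ i, ∑ a, blockLen z p i a =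
      p + innerCount z + (5 + (6 * (192 * z - 3) + (7 * (28 * z) + 9 * (8 * (3 * z - 1))))) := by
  have hs : ∀ j : Fin (192 * z - 3), ∑ a, singleLen j a = ∑ a, (singleLen j a - 1) + 6 :=
    fun j => sum_singleLen j
  have ht : ∀ (d : Fin 4) (m : Fin (7 * z)),
      ∑ a, thetaLen z d m a = ∑ a, (thetaLen z d m a - 1) + 7 := fun d m => sum_thetaLen hz d m
  have hw : ∀ (d : Fin 4) (h : Fin 2) (m : Fin (3 * z - 1)),
      ∑ a, wheelLen z d h m a = ∑ a, (wheelLen z d h m a - 1) + 9 :=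
    fun d h m => sum_wheelLen hz d h (by omega)
  simp only [BlockIndex, Fintype.sum_option, Fintype.sum_sum_type, Fintype.sum_prod_type, blockLen,
    sum_padLen, sum_padLen_sub, innerCount, hs, ht, hw, Finset.sum_add_distrib, Finset.sum_const,
    Finset.card_univ, Fintype.card_prod, Fintype.card_fin, smul_eq_mul]
  ring

theorem two_mul_sum_fin (n : ℕ) : 2 * ∑ j : Fin n, (j : ℕ) = n * (n - 1) := by
  rw [Fin.sum_univ_eq_sum_range (fun i => i) n, mul_comm, Finset.sum_range_id_mul_two]

/-- The blocks (with a bridge of length `1` at the padding tree) and the root have at most `48996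
* z ^ 2` vertices. -/
theorem innerCount_le {z : ℕ} (hz : 1 ≤ z) :
    1 + 5 * Fintype.card (BlockIndex z) + innerCount z ≤ 48996 * z ^ 2 := by
  have hs : 2 * ∑ j : Fin (192 * z - 3), ∑ a, (singleLen j a - 1) =
      (192 * z - 3) * (192 * z - 3 - 1) := by
    simp only [sum_singleLen_sub]
    exact two_mul_sum_fin _
  have ht : ∑ d : Fin 4, ∑ m : Fin (7 * z), ∑ a, (thetaLen z d m a - 1) ≤
      4 * (7 * z * (330 * z) + 3 * (7 * z * (7 * z - 1))) := by
    calc _ ≤ ∑ d : Fin 4, ∑ m : Fin (7 * z), (330 * z + 6 * (m : ℕ)) :=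
          Finset.sum_le_sum fun d _ => Finset.sum_le_sum fun m _ => sum_thetaLen_sub_le hz d m
      _ = _ := by
          rw [← two_mul_sum_fin]
          simp only [Finset.sum_add_distrib, ← Finset.mul_sum, Finset.sum_const, Finset.card_univ,
            Fintype.card_fin, smul_eq_mul]
          ring
  have hw : ∑ d : Fin 4, ∑ h : Fin 2, ∑ m : Fin (3 * z - 1), ∑ a, (wheelLen z d h m a - 1) ≤
      4 * ((3 * z - 1) * (1728 * z)) := by
    calc _ ≤ ∑ d : Fin 4, ∑ h : Fin 2, ∑ m : Fin (3 * z - 1), (852 * z + 24 * z * (h : ℕ)) :=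
          Finset.sum_le_sum fun d _ => Finset.sum_le_sum fun h _ => Finset.sum_le_sum fun m _ =>
            sum_wheelLen_sub_le hz d h (by omega)
      _ = _ := by
          simp only [Finset.sum_const, Finset.card_univ, Fintype.card_fin, smul_eq_mul,
            Fin.sum_univ_two, Fin.val_zero, Fin.val_one]
          ring
  rw [card_blockIndex, innerCount]
  obtain ⟨y, rfl⟩ : ∃ y, z = y + 1 := ⟨z - 1, by omega⟩
  rw [show 192 * (y + 1) - 3 = 192 * y + 189 by omega,
    show 192 * y + 189 - 1 = 192 * y + 188 by omega] at hs
  rw [show 7 * (y + 1) - 1 = 7 * y + 6 by omega] at ht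
  rw [show 3 * (y + 1) - 1 = 3 * y + 2 by omega] at hw ⊢
  rw [show 192 * (y + 1) - 3 = 192 * y + 189 by omega]
  nlinarith

/-- For `z ≥ 1` every `n ≥ 48996 * z ^ 2` admits a simple graph with distinct cycle lengths, `n`
vertices and `n + 344 * z - 36` edges. -/
theorem exists_mem_simpleEdgeCounts {z n : ℕ} (hz : 1 ≤ z) (hn : 48996 * z ^ 2 ≤ n) :
    n + 344 * z - 36 ∈ simpleEdgeCounts n := by
  have hV := innerCount_le hz
  obtain ⟨p, hp⟩ := Nat.exists_eq_add_of_le (hV.trans hn)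
  have h := sum_mem_simpleEdgeCounts (blockLen z p) (three_le_blockLen_cycle hz p)
    (blockLen_cycle_injective hz p)
  rw [sum_blockLen_sub, sum_blockLen hz] at h
  convert h using 2
  · rw [hp]
    ring
  · rw [hp, card_blockIndex]
    omega

theorem theorem6 (r t n : ℕ) (hr : 1 ≤ r) (ht : t = 1260 * r + 169)
    (hn : (1309 / 2 : ℝ) * (t : ℝ) ^ 2 - (1349159 / 6 : ℝ) * (t : ℝ) + 6932215 / 3 ≤ (n : ℝ)) :
    (n : ℝ) + (119 / 3 : ℝ) * (t : ℝ) - 26399 / 3 ≤ (maxEdges n : ℝ) ∧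
      (n : ℝ) + (119 / 3 : ℝ) * (t : ℝ) - 26399 / 3 ≤ (maxEdgesSimple n : ℝ) := by
  -- As `119 / 3 * t` grows like `49980 * r`, the value of `344 * z` has to be about that much, so
  -- that `z` is about `12495 / 86 * r`. The margin `344` makes `48996 * z ^ 2 ≤ n` true for small `r`
  -- too, and the constant term of the bound on the edges allows for it.
  obtain ⟨z, hz, hz', hz1⟩ : ∃ z : ℕ, 86 * z + 344 ≤ 12495 * r ∧ 12495 * r < 86 * z + 430 ∧
      1 ≤ z := ⟨(12495 * r - 344) / 86, by omega, by omega, by omega⟩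
  have hzR : (86 : ℝ) * z + 344 ≤ 12495 * r := by exact_mod_cast hz
  have hzR' : (12495 : ℝ) * r < 86 * z + 430 := by exact_mod_cast hz'
  have hrR : (1 : ℝ) ≤ r := by exact_mod_cast hr
  have htR : (t : ℝ) = 1260 * r + 169 := by rw [ht]; push_cast; ring
  have hn' : 48996 * z ^ 2 ≤ n := by
    have hsq : ((86 : ℝ) * z) ^ 2 ≤ (12495 * r - 344) ^ 2 :=
      pow_le_pow_left₀ (by positivity) (by linarith) 2
    have : (48996 : ℝ) * (z : ℝ) ^ 2 ≤ n := by
      rw [htR] at hn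
      nlinarith
    exact_mod_cast this
  have hmem := exists_mem_simpleEdgeCounts hz1 hn'
  have bound : ∀ M : ℕ, n + 344 * z - 36 ≤ M →
      (n : ℝ) + (119 / 3 : ℝ) * (t : ℝ) - 26399 / 3 ≤ (M : ℝ) := by
    intro M hM
    have : (n : ℝ) + 344 * z ≤ M + 36 := by
      have : n + 344 * z ≤ M + 36 := by omega
      exact_mod_cast this
    rw [htR]
    linarith
  exact ⟨bound _ ((isGreatest_maxEdges n).2 (simpleEdgeCounts_subset n hmem)),
    bound _ ((isGreatest_maxEdgesSimple n).2 hmem)⟩
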